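/- Let $F$ be a field of characteristic zero, let $G=N\rtimes K$ be a semidirect product of groups, and let $H$ be a normal subgroup of $N$ such that $(G,H)$ is a Hecke pair, i.e. every double coset $HxH$ $(x\in G)$ is a union of finitely many right cosets $Hg$; write $R(x)$ for their number. For $x\in G$ let $\sigma_x$ be the linear operator on the $F$-vector space with basis $\{\delta_{Ht}: Ht\in H\backslash G\}$ which sends $\delta_{Ht}$ to $\frac1{R(x)}\sum_v\delta_v$, where $v$ runs over the right cosets of $H$ contained in $HxHt$. The Hecke algebra $\mathcal H(G,H)$ is the algebra of operators generated by $\{\sigma_x: x\in G\}$. A partial action of $K$ on a unital $F$-algebra $A$ consists of two-sided ideals $D_t$ of $A$ and algebra isomorphisms $\theta_t:D_{t^{-1}}\to D_t$ $(t\in K)$ such that $D_1=A$, $\theta_1=\mathrm{id}_A$, $\theta_r(D_{r^{-1}}\cap D_s)=D_r\cap D_{rs}$, and $\theta_r(\theta_s(a))=\theta_{rs}(a)$ for $a\in D_{s^{-1}}\cap D_{s^{-1}r^{-1}}$. Its crossed product $A\rtimes K$ is the space $\bigoplus_{t\in K}D_t$, with $a\in D_t$ in the summand of $t$ written $a\delta_t$,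 and with the bilinear multiplication $(a\delta_r)(b\delta_s)=\theta_r(\theta_r^{-1}(a)b)\,\delta_{rs}$. Then there is an (untwisted) partial action $(\{D_t\},\{\theta_t\})$ of $K$ on the group algebra $F[N/H]$ such that $$\mathcal H(G,H)\;\cong\;F[N/H]\rtimes K$$ as $F$-algebras. More precisely, there is an injective unital algebra homomorphism $\iota:F[N/H]\to\mathcal H(G,H)$ with $\iota(nH)=\sigma_n$ for $n\in N$, and the partial action and the isomorphism $\Phi:F[N/H]\rtimes K\to\mathcal H(G,H)$ can be chosen so that, for all $t\in K$, one has $\iota(D_t)=\iota(F[N/H])\cap\sigma_t\sigma_{t^{-1}}\iota(F[N/H])$, $\iota(\theta_t(a))=\sigma_t\,\iota(a)\,\sigma_{t^{-1}}$ for $a\in D_{t^{-1}}$, and $\Phi(a\delta_t)=\iota(a)\,\sigma_t$ for $a\in D_t$. -/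

import Mathlib

open scoped DirectSum

noncomputable section

namespace HeckeCrossed

section Hecke

variable {G : Type*} [Group G]

/-- The space `H \ G` of right cosets `Hg`. -/
abbrev RightCosets (H : Subgroup G) : Type _ := Quotient (QuotientGroup.rightRel H)

/-- The right coset `Hg`. -/
def rightCoset (H : Subgroup G) (g : G) : RightCosets H := Quotient.mk _ g

/-- The set of right cosets contained in the double coset `HxH`. -/
def cosetsInDouble (H : Subgroup G) (x : G) : Set (RightCosets H) :=
  rightCoset H '' DoubleCoset.doubleCoset x H H

/-- `(G, H)` is a Hecke pair: every double coset `HxH` is a finite union of right cosets. -/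
def IsHeckePair (H : Subgroup G) : Prop :=
  ∀ x : G, (cosetsInDouble H x).Finite

/-- `R(x)`, the number of right cosets in `HxH`. -/
def cosetCount (H : Subgroup G) (x : G) : ℕ := (cosetsInDouble H x).ncard

/-- For a right coset `u = Ht`, the set of right cosets contained in `HxHt = Hxu`. -/
def translates (H : Subgroup G) (x : G) (u : RightCosets H) : Set (RightCosets H) :=
  {v | ∃ t : G, rightCoset H t = u ∧ rightCoset H (x * t) = v}

variable (F : Type*) [Field F]

/-- The operator `σ_x` on the vector space with basis `H \ G`; it sends `δ_{Ht}` to the average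
`R(x)⁻¹ ∑ δ_v` over the right cosets `v` making up `HxHt`. -/
def heckeOp (H : Subgroup G) (x : G) : Module.End F (RightCosets H →₀ F) :=
  Finsupp.linearCombination F fun u : RightCosets H =>
    (cosetCount H x : F)⁻¹ • ∑ᶠ v ∈ translates H x u, Finsupp.single v (1 : F)

/-- The Hecke algebra: the algebra of operators generated by all the `σ_x`. -/
def heckeAlgebra (H : Subgroup G) : Subalgebra F (Module.End F (RightCosets H →₀ F)) :=
  Algebra.adjoin F (Set.range (heckeOp F H))

/-- `σ_x` as an element of the Hecke algebra. -/
def sigma (H : Subgroup G) (x : G) : heckeAlgebra F H :=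
  ⟨heckeOp F H x, Algebra.subset_adjoin ⟨x, rfl⟩⟩

end Hecke

/-- An (untwisted) partial action of a group `K` on a unital `F`-algebra `A`: two-sided ideals
`D t` and algebra isomorphisms `θ t : D t⁻¹ → D t`. -/
structure PartialAction (F K A : Type*) [Field F] [Group K] [Ring A] [Algebra F A] where
  D : K → Ideal A
  twoSided : ∀ t, (D t).IsTwoSided
  θ : ∀ t, D t⁻¹ ≃ₗ[F] D t
  map_mul : ∀ (t : K) (a b : D t⁻¹),
    (θ t ⟨(a : A) * b, (D t⁻¹).mul_mem_left a b.2⟩ : A) = (θ t a : A) * θ t b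
  D_one : D 1 = ⊤
  θ_one : ∀ a : D 1⁻¹, (θ 1 a : A) = a
  image_inter : ∀ r s : K,
    (fun a : D r⁻¹ => (θ r a : A)) '' {a | (a : A) ∈ D s} = (D r : Set A) ∩ D (r * s)
  /-- `θ_r (θ_s a) = θ_{rs} a` for `a` in `D s⁻¹ ∩ D (rs)⁻¹`; by `image_inter` the
  hypothesis `h` holds for every such `a`. -/
  comp : ∀ (r s : K) (a : A) (hs : a ∈ D s⁻¹) (hrs : a ∈ D (r * s)⁻¹)
    (h : (θ s ⟨a, hs⟩ : A) ∈ D r⁻¹), (θ r ⟨θ s ⟨a, hs⟩, h⟩ : A) = θ (r * s) ⟨a, hrs⟩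

namespace PartialAction

variable {F K A : Type*} [Field F] [Group K] [Ring A] [Algebra F A] (Θ : PartialAction F K A)

theorem mul_mem_inv (g : K) (a : Θ.D g) (b : A) : ((Θ.θ g).symm a : A) * b ∈ Θ.D g⁻¹ :=
  haveI := Θ.twoSided g⁻¹
  (Θ.D g⁻¹).mul_mem_right b ((Θ.θ g).symm a).2

theorem mul_mem_prod (g h : K) (a : Θ.D g) (b : Θ.D h) :
    (Θ.θ g ⟨((Θ.θ g).symm a : A) * b, Θ.mul_mem_inv g a b⟩ : A) ∈ Θ.D (g * h) := by
  have := Θ.image_inter g h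
  exact (this.subset ⟨⟨((Θ.θ g).symm a : A) * b, Θ.mul_mem_inv g a b⟩,
    (Θ.D h).mul_mem_left _ b.2, rfl⟩).2

/-- The element `θ_g⁻¹(a) b` of `D g⁻¹`. -/
def pull (g h : K) (a : Θ.D g) (b : Θ.D h) : Θ.D g⁻¹ :=
  ⟨((Θ.θ g).symm a : A) * b, Θ.mul_mem_inv g a b⟩

/-- The bilinear map `D g × D h → D (gh)`, `(a, b) ↦ θ_g (θ_g⁻¹(a) b)`. -/
def mulComponent (g h : K) : Θ.D g →ₗ[F] Θ.D h →ₗ[F] Θ.D (g * h) :=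
  LinearMap.mk₂ F (fun a b => ⟨Θ.θ g (Θ.pull g h a b), Θ.mul_mem_prod g h a b⟩)
    (fun a a' b => Subtype.ext <| by
      have : Θ.pull g h (a + a') b = Θ.pull g h a b + Θ.pull g h a' b :=
        Subtype.ext (by simp [pull, add_mul])
      simp [this])
    (fun c a b => Subtype.ext <| by
      have : Θ.pull g h (c • a) b = c • Θ.pull g h a b := Subtype.ext (by simp [pull])
      simp [this])
    (fun a b b' => Subtype.ext <| by
      have : Θ.pull g h a (b + b') = Θ.pull g h a b + Θ.pull g h a b' :=
        Subtype.ext (by simp [pull, mul_add])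
      simp [this])
    (fun c a b => Subtype.ext <| by
      have : Θ.pull g h a (c • b) = c • Θ.pull g h a b := Subtype.ext (by simp [pull])
      simp [this])

/-- The underlying space `⨁ g, D g` of the crossed product of `A` by `K`. -/
def CrossedProduct : Type _ := ⨁ g : K, Θ.D g

instance : AddCommGroup Θ.CrossedProduct := inferInstanceAs (AddCommGroup (⨁ g : K, Θ.D g))

instance : Module F Θ.CrossedProduct := inferInstanceAs (Module F (⨁ g : K, Θ.D g))

open Classical in
/-- The element `a δ_g` of the crossed product, for `a` in `D g`. -/
def δ (g : K) : Θ.D g →ₗ[F] Θ.CrossedProduct := DirectSum.lof F K (fun g => Θ.D g) g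

open Classical in
/-- Linear maps out of the crossed product, given on each summand `D g`. -/
def lift {M : Type*} [AddCommGroup M] [Module F M] (f : ∀ g, Θ.D g →ₗ[F] M) :
    Θ.CrossedProduct →ₗ[F] M := DirectSum.toModule F K M f

theorem lift_δ {M : Type*} [AddCommGroup M] [Module F M] (f : ∀ g, Θ.D g →ₗ[F] M) (g : K)
    (a : Θ.D g) : Θ.lift f (Θ.δ g a) = f g a := by
  classical
  exact DirectSum.toModule_lof (M := fun g => Θ.D g) (φ := f) F g a

/-- The bilinear multiplication with `(a δ_g)(b δ_h) = θ_g (θ_g⁻¹(a) b) δ_{gh}`. -/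
def mulHom : Θ.CrossedProduct →ₗ[F] Θ.CrossedProduct →ₗ[F] Θ.CrossedProduct :=
  Θ.lift fun g => LinearMap.flip <| Θ.lift fun h =>
    LinearMap.flip <| (Θ.mulComponent g h).compr₂ (Θ.δ (g * h))

instance : Mul Θ.CrossedProduct := ⟨fun a b => Θ.mulHom a b⟩

theorem δ_mul_δ (g h : K) (a : Θ.D g) (b : Θ.D h) :
    Θ.δ g a * Θ.δ h b = Θ.δ (g * h) (Θ.mulComponent g h a b) := by
  change Θ.mulHom (Θ.δ g a) (Θ.δ h b) = _
  simp only [mulHom, lift_δ, LinearMap.flip_apply, LinearMap.compr₂_apply]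

end PartialAction

end HeckeCrossed

end

/-! Since `H` is normal in `N`, the right coset `Hns` is determined by `nH` and `s`, so the space
with basis `H \ G` is a direct sum over `s` in `K` of copies of `F[N/H]`. Let `P_t` be the image of
`φ_t(H)` in `N/H`. It is normal, the Hecke condition makes it finite, and in characteristic zero its
average `e_t` is a central idempotent. On this decomposition `σ_{nt}` sends the copy of `s` to that
of `ts` by `a ↦ n T_t(a)`, where `T_t(mH) = e_t φ_t(m)H` (`heckeOp_embed`).

Each `T_t` is multiplicative, and `T_t T_r = e_t T_{tr}` (`twist_twist`), which rests on `T_t(e_r) =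
e_t e_{tr}` (`twist_average`). Any such family gives an untwisted partial action on the ideals
generated by the `T_t(1) = e_t` (`Compression.partialAction`).

The relations `σ_t ι(a) = ι(T_t a) σ_t` and `σ_t σ_r = ι(e_t) σ_{tr}` make `a δ_t ↦ ι(a) σ_t`
multiplicative (`crossedProductMap_mul`). It is onto because `σ_{nt} = σ_n σ_t`, and injective
because the value of an operator at the coset `H` determines all coefficients. -/

noncomputable section

namespace HeckeCrossed

namespace PartialAction

variable {F K A : Type*} [Field F] [Group K] [Ring A] [Algebra F A]

/-! ### Coefficients in the crossed product -/

section Components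

variable (Θ : PartialAction F K A)

theorem crossedProduct_induction {p : Θ.CrossedProduct → Prop} (x : Θ.CrossedProduct)
    (zero : p 0) (δ : ∀ t a, p (Θ.δ t a)) (add : ∀ x y, p x → p y → p (x + y)) : p x := by
  classical
  exact DirectSum.induction_on x zero δ add

/-- The coefficient of `δ_t` in an element of the crossed product. -/
def component (t : K) : Θ.CrossedProduct →ₗ[F] Θ.D t :=
  DirectSum.component F K (fun g => Θ.D g) t

theorem component_δ_self (t : K) (a : Θ.D t) : Θ.component t (Θ.δ t a) = a := by
  classical
  exact DirectSum.component.lof_self F (M := fun g => Θ.D g) t a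

theorem component_δ_of_ne {s t : K} (h : s ≠ t) (a : Θ.D s) : Θ.component t (Θ.δ s a) = 0 := by
  classical
  exact (DirectSum.component.of F (M := fun g => Θ.D g) t s a).trans (dif_neg h)

theorem crossedProduct_ext {x y : Θ.CrossedProduct}
    (h : ∀ t, Θ.component t x = Θ.component t y) : x = y :=
  DirectSum.ext_component F h

end Components

/-! ### Partial actions from compressions -/

/-- Multiplicative linear maps `T t : A → A` which form a partial representation of `K` up to the
central elements `T t 1`. They induce a partial action on the ideals generated by these elements. -/
structure Compression (F K A : Type*) [Field F] [Group K] [Ring A] [Algebra F A] where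
  T : K → A →ₗ[F] A
  map_mul : ∀ t a b, T t (a * b) = T t a * T t b
  one : ∀ a, T 1 a = a
  central : ∀ t a, T t 1 * a = a * T t 1
  comp : ∀ r s a, T r (T s a) = T r 1 * T (r * s) a

namespace Compression

variable (C : Compression F K A)

theorem one_mul_map (t : K) (a : A) : C.T t 1 * C.T t a = C.T t a := by
  rw [← C.map_mul, one_mul]

theorem map_map_inv (t : K) (a : A) : C.T t (C.T t⁻¹ a) = C.T t 1 * a := by
  rw [C.comp, mul_inv_cancel, C.one]

theorem map_inv_map (t : K) (a : A) : C.T t⁻¹ (C.T t a) = C.T t⁻¹ 1 * a := by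
  rw [C.comp, inv_mul_cancel, C.one]

/-- The ideal generated by the central idempotent `T t 1`. -/
def ideal (t : K) : Ideal A where
  carrier := {a | C.T t 1 * a = a}
  add_mem' {a b} ha hb := by
    simp only [Set.mem_ofPred_eq] at ha hb ⊢
    rw [mul_add, ha, hb]
  zero_mem' := mul_zero _
  smul_mem' c a ha := by
    simp only [Set.mem_ofPred_eq, smul_eq_mul] at ha ⊢
    rw [← mul_assoc, C.central, mul_assoc, ha]

theorem mem_ideal {t : K} {a : A} : a ∈ C.ideal t ↔ C.T t 1 * a = a := Iff.rfl

theorem mem_ideal_iff_exists {t : K} {a : A} : a ∈ C.ideal t ↔ ∃ b, a = C.T t 1 * b := by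
  refine ⟨fun h => ⟨a, h.symm⟩, ?_⟩
  rintro ⟨b, rfl⟩
  rw [mem_ideal, ← mul_assoc, one_mul_map]

theorem map_mem_ideal (t : K) (a : A) : C.T t a ∈ C.ideal t := C.one_mul_map t a

/-- From `a = T_s(1) a` follows `T_r(a) = T_r(T_s(1)) T_r(a)`, and `T_r(T_s(1)) = T_r(1) T_{rs}(1)`
contains the generator of the ideal of `rs`. -/
theorem map_mem_ideal_mul {r s : K} {a : A} (ha : a ∈ C.ideal s) : C.T r a ∈ C.ideal (r * s) := by
  have h : C.T r a = C.T (r * s) 1 * (C.T r 1 * C.T r a) := by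
    conv_lhs => rw [← C.mem_ideal.1 ha, C.map_mul, C.comp, C.central, mul_assoc]
  exact C.mem_ideal_iff_exists.2 ⟨_, h⟩

/-- The isomorphism between the ideals of `t⁻¹` and `t`. -/
def idealEquiv (t : K) : C.ideal t⁻¹ ≃ₗ[F] C.ideal t where
  toFun a := ⟨C.T t a, C.map_mem_ideal t a⟩
  map_add' a b := Subtype.ext (by simp)
  map_smul' c a := Subtype.ext (by simp)
  invFun a := ⟨C.T t⁻¹ a, C.map_mem_ideal t⁻¹ a⟩
  left_inv a := Subtype.ext ((C.map_inv_map t a).trans a.2)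
  right_inv a := Subtype.ext ((C.map_map_inv t a).trans a.2)

/-- The partial action on the ideals generated by the central idempotents `T t 1`. -/
def partialAction : PartialAction F K A where
  D := C.ideal
  twoSided t := ⟨fun {a} b ha => by
    rw [mem_ideal] at ha ⊢
    rw [← mul_assoc, ha]⟩
  θ := C.idealEquiv
  map_mul t a b := C.map_mul t a b
  D_one := by
    ext a
    simp [mem_ideal, C.one]
  θ_one a := C.one a
  image_inter r s := by
    ext b
    constructor
    · rintro ⟨a, ha, rfl⟩
      exact ⟨C.map_mem_ideal r a, C.map_mem_ideal_mul ha⟩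
    · rintro ⟨h, h'⟩
      -- `T_{r⁻¹}` inverts `T_r` on the ideal of `r`, and maps the ideal of `rs` into that of
      -- `r⁻¹(rs) = s`.
      refine ⟨⟨C.T r⁻¹ b, C.map_mem_ideal _ _⟩, ?_, (C.map_map_inv r b).trans h⟩
      simpa using C.map_mem_ideal_mul (r := r⁻¹) h'
  comp r s a hs hrs h := by
    change C.T r (C.T s a) = C.T (r * s) a
    rw [C.comp]
    -- As `a` lies in the ideal of `s⁻¹`, `T_{rs}(a)` lies in that of `(rs)s⁻¹ = r`, so the factor
    -- `T_r(1)` is absorbed.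
    have h' := C.map_mem_ideal_mul (r := r * s) hs
    rw [mul_inv_cancel_right] at h'
    exact h'

/-! ### Covariant maps out of the crossed product -/

variable {B : Type*} [Semiring B] [Algebra F B] (ι : A →ₐ[F] B) (S : K → B)

open Classical in
/-- The linear map `a δ_t ↦ ι(a) S(t)` out of the crossed product. -/
def crossedProductMap : C.partialAction.CrossedProduct →ₗ[F] B :=
  DirectSum.toModule F K B fun t =>
    (LinearMap.mulRight F (S t) ∘ₗ ι.toLinearMap) ∘ₗ (C.ideal t).subtype.restrictScalars F

theorem crossedProductMap_δ (t : K) (a : C.partialAction.D t) :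
    C.crossedProductMap ι S (C.partialAction.δ t a) = ι a * S t := by
  classical
  exact DirectSum.toModule_lof (M := fun g => C.ideal g) F t a

/-- Covariance moves `S_r` past `ι(b)`, so `ι(a) S_r ι(b) S_s = ι(a T_r(b) T_r(1)) S_{rs}`. The
idempotent `T_r(1)` is absorbed by `T_r(b)`, and `a T_r(b)` is the product coefficient. -/
theorem crossedProductMap_mul (hcov : ∀ t a, S t * ι a = ι (C.T t a) * S t)
    (hS : ∀ r s, S r * S s = ι (C.T r 1) * S (r * s))
    (x y : C.partialAction.CrossedProduct) :
    C.crossedProductMap ι S (x * y) = C.crossedProductMap ι S x * C.crossedProductMap ι S y := by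
  change C.crossedProductMap ι S (C.partialAction.mulHom x y) = _
  induction x using crossedProduct_induction with
  | zero => simp
  | add x x' hx hx' => simp [add_mul, hx, hx']
  | δ r a =>
    induction y using crossedProduct_induction with
    | zero => simp
    | add y y' hy hy' => simp [mul_add, hy, hy']
    | δ s b =>
      have hmul : ((C.partialAction.mulComponent r s a b : C.partialAction.D (r * s)) : A) =
          a * C.T r b := by
        change C.T r (C.T r⁻¹ a * b) = _
        rw [C.map_mul, C.map_map_inv, C.mem_ideal.1 a.2]
      change C.crossedProductMap ι S (C.partialAction.δ r a * C.partialAction.δ s b) = _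
      rw [δ_mul_δ, crossedProductMap_δ, crossedProductMap_δ, crossedProductMap_δ, hmul,
        mul_assoc (ι a), ← mul_assoc (S r), hcov, mul_assoc (ι _) (S r), hS, ← mul_assoc,
        ← mul_assoc, ← _root_.map_mul, ← _root_.map_mul, mul_assoc (a : A), ← C.central,
        one_mul_map]

/-- Used for surjectivity: when `S_t` absorbs `ι(T_t(1))`, an arbitrary coefficient may be cut down
to the ideal of `t`. -/
theorem mul_crossedProductMap_mem (t : K) (h : ι (C.T t 1) * S t = S t) (a : A) :
    ι a * S t ∈ LinearMap.range (C.crossedProductMap ι S) :=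
  ⟨C.partialAction.δ t ⟨C.T t 1 * a, C.mem_ideal_iff_exists.2 ⟨a, rfl⟩⟩, by
    rw [crossedProductMap_δ]
    change ι (C.T t 1 * a) * S t = _
    rw [C.central, _root_.map_mul, mul_assoc, h]⟩

end Compression

end PartialAction

/-! ### Averages over finite subgroups -/

section Average

variable (F : Type*) [Field F] {Q : Type*} [Group Q] (P : Subgroup Q)

/-- The average of the elements of a finite subgroup, in the group algebra. -/
def average : MonoidAlgebra F Q :=
  (Nat.card P : F)⁻¹ • ∑ᶠ p ∈ (P : Set Q), MonoidAlgebra.of F Q p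

variable {F P}

theorem map_average (hP : (P : Set Q).Finite) {M : Type*} [AddCommGroup M] [Module F M]
    (f : MonoidAlgebra F Q →ₗ[F] M) :
    f (average F P) = (Nat.card P : F)⁻¹ • ∑ᶠ p ∈ (P : Set Q), f (MonoidAlgebra.of F Q p) := by
  rw [average, map_smul, finsum_mem_eq_finite_toFinset_sum _ hP,
    finsum_mem_eq_finite_toFinset_sum _ hP, map_sum]

/-- Characteristic zero enters here, to make the order of `P` invertible in `F`. -/
theorem map_average_of_const [CharZero F] (hP : (P : Set Q).Finite) {M : Type*} [AddCommGroup M]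
    [Module F M] (f : MonoidAlgebra F Q →ₗ[F] M) (x : M)
    (h : ∀ p ∈ P, f (MonoidAlgebra.of F Q p) = x) : f (average F P) = x := by
  have hc : (Nat.card P : F) ≠ 0 := by
    have : Finite P := hP
    exact_mod_cast Nat.card_pos.ne'
  rw [map_average hP, finsum_mem_congr rfl h, finsum_mem_eq_finite_toFinset_sum _ hP,
    Finset.sum_const, ← Set.ncard_eq_toFinset_card _ hP, ← Nat.cast_smul_eq_nsmul F, smul_smul]
  change ((Nat.card P : F)⁻¹ * (Nat.card P : F)) • x = x
  rw [inv_mul_cancel₀ hc, one_smul]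

theorem of_mul_average (hP : (P : Set Q).Finite) {q : Q} (hq : q ∈ P) :
    MonoidAlgebra.of F Q q * average F P = average F P := by
  have h := map_average (F := F) hP (LinearMap.mulLeft F (MonoidAlgebra.of F Q q))
  rw [LinearMap.mulLeft_apply] at h
  rw [h, average]
  congr 1
  refine finsum_mem_eq_of_bijOn (fun p => q * p) ⟨fun p hp => P.mul_mem hq hp,
    (mul_right_injective q).injOn, fun p hp => ⟨q⁻¹ * p, P.mul_mem (P.inv_mem hq) hp, by simp⟩⟩ ?_
  intro p _
  rw [LinearMap.mulLeft_apply, ← map_mul]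

theorem average_mul_comm [P.Normal] (hP : (P : Set Q).Finite) (a : MonoidAlgebra F Q) :
    average F P * a = a * average F P := by
  induction a using MonoidAlgebra.induction_on with
  | of q =>
    have h := map_average (F := F) hP (LinearMap.mulLeft F (MonoidAlgebra.of F Q q))
    have h' := map_average (F := F) hP (LinearMap.mulRight F (MonoidAlgebra.of F Q q))
    rw [LinearMap.mulLeft_apply] at h
    rw [LinearMap.mulRight_apply] at h'
    rw [h, h']
    congr 1
    -- Normality makes conjugation a permutation of `P`, matching `q p'` for `p' = q⁻¹pq` with `p
    -- q`.
    refine finsum_mem_eq_of_bijOn (fun p => q⁻¹ * p * q) ⟨fun p hp => ?_, ?_, fun p hp => ?_⟩ ?_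
    · simpa using Subgroup.Normal.conj_mem ‹P.Normal› p hp q⁻¹
    · intro p _ p' _ h
      simpa using h
    · exact ⟨q * p * q⁻¹, Subgroup.Normal.conj_mem ‹P.Normal› p hp q, by group⟩
    · intro p _
      rw [LinearMap.mulLeft_apply, LinearMap.mulRight_apply, ← map_mul, ← map_mul]
      congr 1
      group
  | add a b ha hb => rw [mul_add, add_mul, ha, hb]
  | smul c a ha => rw [mul_smul_comm, smul_mul_assoc, ha]

theorem average_mul_of [P.Normal] (hP : (P : Set Q).Finite) {q : Q} (hq : q ∈ P) :
    average F P * MonoidAlgebra.of F Q q = average F P := by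
  rw [average_mul_comm hP, of_mul_average hP hq]

theorem average_mul_average [CharZero F] (hP : (P : Set Q).Finite) :
    average F P * average F P = average F P :=
  map_average_of_const hP (LinearMap.mulRight F (average F P)) _ fun _ hp => of_mul_average hP hp

end Average

/-! ### Right cosets and double cosets in the semidirect product -/

section Semidirect

open SemidirectProduct

variable {F N K : Type*} [Field F] [Group N] [Group K] (φ : K →* MulAut N) (H : Subgroup N)

theorem inl_mul_inr_mul (n m : N) (t s : K) :
    (inl n * inr t * (inl m * inr s) : N ⋊[φ] K) = inl (n * φ t m) * inr (t * s) := by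
  ext <;> simp

theorem exists_eq_inl_mul_inr (g : N ⋊[φ] K) : ∃ n t, g = inl n * inr t :=
  ⟨g.left, g.right, (inl_left_mul_inr_right g).symm⟩

variable [H.Normal]

/-- The image in `N ⧸ H` of the conjugate `t H t⁻¹`. -/
def conjImage (t : K) : Subgroup (N ⧸ H) :=
  (H.map (φ t).toMonoidHom).map (QuotientGroup.mk' H)

theorem mem_conjImage {t : K} {q : N ⧸ H} :
    q ∈ conjImage φ H t ↔ ∃ h ∈ H, ((φ t h : N) : N ⧸ H) = q := by
  simp [conjImage]

instance conjImage_normal (t : K) : (conjImage φ H t).Normal := by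
  have : (H.map (φ t).toMonoidHom).Normal := ‹H.Normal›.map _ (φ t).surjective
  exact this.map _ (QuotientGroup.mk'_surjective H)

theorem rightCoset_eq_iff {n m : N} {s t : K} :
    rightCoset (H.map (inl : N →* N ⋊[φ] K)) (inl n * inr s) =
      rightCoset (H.map (inl : N →* N ⋊[φ] K)) (inl m * inr t) ↔
    (n : N ⧸ H) = m ∧ s = t := by
  have key : ∀ k : K, (inl m * inr k * (inl n * inr k)⁻¹ : N ⋊[φ] K) = inl (m * n⁻¹) := by
    intro k
    rw [map_mul, map_inv]
    group
  rw [rightCoset, rightCoset, Quotient.eq, QuotientGroup.rightRel_apply]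
  constructor
  · rintro ⟨h, hh, e⟩
    have hst : s = t := by
      have := congrArg SemidirectProduct.right e
      simp only [right_inl, mul_right, right_inr, one_mul, inv_right] at this
      exact (mul_inv_eq_one.1 this.symm).symm
    subst hst
    rw [key] at e
    obtain rfl := inl_injective e
    exact ⟨QuotientGroup.eq.2 (‹H.Normal›.mem_comm hh), rfl⟩
  · rintro ⟨h, rfl⟩
    rw [key]
    exact ⟨_, ‹H.Normal›.mem_comm (QuotientGroup.eq.1 h), rfl⟩

/-- The right coset `H n s`, for `q = n H`. -/
def cosetOf (s : K) (q : N ⧸ H) : RightCosets (H.map (inl : N →* N ⋊[φ] K)) :=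
  rightCoset _ (inl q.out * inr s)

theorem cosetOf_mk (s : K) (n : N) :
    cosetOf φ H s n = rightCoset (H.map (inl : N →* N ⋊[φ] K)) (inl n * inr s) :=
  (rightCoset_eq_iff φ H).2 ⟨QuotientGroup.out_eq' _, rfl⟩

theorem cosetOf_inj {s t : K} {p q : N ⧸ H} :
    cosetOf φ H s p = cosetOf φ H t q ↔ p = q ∧ s = t := by
  obtain ⟨n, rfl⟩ := QuotientGroup.mk_surjective p
  obtain ⟨m, rfl⟩ := QuotientGroup.mk_surjective q
  rw [cosetOf_mk, cosetOf_mk, rightCoset_eq_iff]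

theorem cosetOf_injective (s : K) : Function.Injective (cosetOf φ H s) :=
  fun _ _ h => ((cosetOf_inj φ H).1 h).1

theorem exists_eq_cosetOf (u : RightCosets (H.map (inl : N →* N ⋊[φ] K))) :
    ∃ (s : K) (n : N), u = cosetOf φ H s n := by
  obtain ⟨g, rfl⟩ := Quotient.exists_rep u
  obtain ⟨n, s, rfl⟩ := exists_eq_inl_mul_inr φ g
  exact ⟨s, n, (cosetOf_mk φ H s n).symm⟩

/-- The representatives of `Hms` are `hms` with `h` in `H`, and `nt · hms = n φ_t(h) φ_t(m) ts`. -/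
theorem translates_cosetOf (n m : N) (t s : K) :
    translates (H.map (inl : N →* N ⋊[φ] K)) (inl n * inr t) (cosetOf φ H s m) =
      (fun p => cosetOf φ H (t * s) ((n : N ⧸ H) * p * (φ t m : N))) ''
        (conjImage φ H t : Set (N ⧸ H)) := by
  ext v
  constructor
  · rintro ⟨g, hg, rfl⟩
    obtain ⟨k, r, rfl⟩ := exists_eq_inl_mul_inr φ g
    rw [cosetOf_mk, rightCoset_eq_iff] at hg
    obtain ⟨hk, rfl⟩ := hg
    refine ⟨(φ t (k * m⁻¹) : N), (mem_conjImage φ H).2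
      ⟨_, ‹H.Normal›.mem_comm (QuotientGroup.eq.1 hk.symm), rfl⟩, ?_⟩
    simp only [← QuotientGroup.mk_mul]
    rw [cosetOf_mk, inl_mul_inr_mul, mul_assoc n, ← map_mul, inv_mul_cancel_right]
  · rintro ⟨p, hp, rfl⟩
    obtain ⟨h, hh, rfl⟩ := (mem_conjImage φ H).1 hp
    refine ⟨inl (h * m) * inr s, ?_, ?_⟩
    · rw [cosetOf_mk, rightCoset_eq_iff]
      refine ⟨?_, rfl⟩
      rw [QuotientGroup.mk_mul, (QuotientGroup.eq_one_iff h).2 hh, one_mul]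
    · simp only [← QuotientGroup.mk_mul]
      rw [cosetOf_mk, inl_mul_inr_mul, map_mul (φ t), mul_assoc n]

theorem cosetsInDouble_eq_translates {G : Type*} [Group G] (L : Subgroup G) (x : G) :
    cosetsInDouble L x = translates L x (rightCoset L 1) := by
  have hL : ∀ t : G, rightCoset L t = rightCoset L 1 ↔ t ∈ L := fun t => by
    rw [rightCoset, rightCoset, Quotient.eq, QuotientGroup.rightRel_apply, one_mul, inv_mem_iff]
  ext v
  constructor
  · rintro ⟨_, hg, rfl⟩
    obtain ⟨a, ha, b, hb, rfl⟩ := DoubleCoset.mem_doubleCoset.1 hg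
    refine ⟨b, (hL b).2 hb, ?_⟩
    rw [rightCoset, rightCoset, Quotient.eq, QuotientGroup.rightRel_apply]
    simpa [mul_assoc] using ha
  · rintro ⟨t, ht, rfl⟩
    exact ⟨x * t, DoubleCoset.mem_doubleCoset.2 ⟨1, L.one_mem, t, (hL t).1 ht, by simp⟩, rfl⟩

theorem cosetsInDouble_inl_mul_inr (n : N) (t : K) :
    cosetsInDouble (H.map (inl : N →* N ⋊[φ] K)) (inl n * inr t) =
      (fun p => cosetOf φ H t ((n : N ⧸ H) * p)) '' (conjImage φ H t : Set (N ⧸ H)) := by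
  have h := translates_cosetOf φ H n 1 t 1
  rw [cosetOf_mk] at h
  rw [cosetsInDouble_eq_translates]
  simpa using h

theorem cosetOf_mul_injective (s : K) (p q : N ⧸ H) :
    Function.Injective fun x => cosetOf φ H s (p * x * q) := fun x y h => by
  simpa using cosetOf_injective φ H s h

theorem cosetCount_inl_mul_inr (n : N) (t : K) :
    cosetCount (H.map (inl : N →* N ⋊[φ] K)) (inl n * inr t) = Nat.card (conjImage φ H t) := by
  have h := cosetOf_mul_injective φ H t n 1
  simp only [mul_one] at h
  rw [cosetCount, cosetsInDouble_inl_mul_inr, Set.ncard_image_of_injective _ h]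
  rfl

variable {φ H}

theorem IsHeckePair.finite_conjImage (hH : IsHeckePair (H.map (inl : N →* N ⋊[φ] K))) (t : K) :
    (conjImage φ H t : Set (N ⧸ H)).Finite := by
  have h := hH (inl 1 * inr t)
  rw [cosetsInDouble_inl_mul_inr] at h
  refine h.of_finite_image (Function.Injective.injOn ?_)
  simpa using cosetOf_mul_injective φ H t (1 : N ⧸ H) 1

/-! ### Hecke operators on the copies of the group algebra -/

variable (F φ H)

/-- The copy of the group algebra of `N ⧸ H` supported on the right cosets in `N s`. -/
def embed (s : K) : MonoidAlgebra F (N ⧸ H) →ₗ[F]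
    (RightCosets (H.map (inl : N →* N ⋊[φ] K)) →₀ F) :=
  Finsupp.lmapDomain F F (cosetOf φ H s) ∘ₗ (MonoidAlgebra.coeffLinearEquiv F).toLinearMap

theorem embed_of (s : K) (q : N ⧸ H) :
    embed F φ H s (MonoidAlgebra.of F _ q) = Finsupp.single (cosetOf φ H s q) 1 := by
  simp [embed]

theorem embed_apply_self (s : K) (a : MonoidAlgebra F (N ⧸ H)) (q : N ⧸ H) :
    embed F φ H s a (cosetOf φ H s q) = a.coeff q :=
  Finsupp.mapDomain_apply (cosetOf_injective φ H s) _ _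

theorem embed_apply_of_ne {s t : K} (h : s ≠ t) (a : MonoidAlgebra F (N ⧸ H)) (q : N ⧸ H) :
    embed F φ H s a (cosetOf φ H t q) = 0 := by
  refine Finsupp.mapDomain_of_notMem_range _ _ ?_
  rintro ⟨p, hp⟩
  exact h ((cosetOf_inj φ H).1 hp).2

variable {F φ H}

theorem end_ext {f g : Module.End F (RightCosets (H.map (inl : N →* N ⋊[φ] K)) →₀ F)}
    (h : ∀ s a, f (embed F φ H s a) = g (embed F φ H s a)) : f = g := by
  refine Finsupp.lhom_ext' fun u => LinearMap.ext_ring ?_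
  obtain ⟨s, n, rfl⟩ := exists_eq_cosetOf φ H u
  have h' := h s (MonoidAlgebra.of F _ n)
  rwa [embed_of] at h'

theorem monoidAlgebra_linearMap_ext {Q M : Type*} [Group Q] [AddCommGroup M] [Module F M]
    {f g : MonoidAlgebra F Q →ₗ[F] M}
    (h : ∀ q, f (MonoidAlgebra.of F Q q) = g (MonoidAlgebra.of F Q q)) : f = g := by
  refine LinearMap.ext fun a => ?_
  induction a using MonoidAlgebra.induction_on with
  | of q => exact h q
  | add a b ha hb => rw [map_add, map_add, ha, hb]
  | smul c a ha => rw [map_smul, map_smul, ha]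

theorem heckeAlgebra_mul_apply {G : Type*} [Group G] {L : Subgroup G} (x y : heckeAlgebra F L)
    (v : RightCosets L →₀ F) : (x * y).1 v = x.1 (y.1 v) := rfl

variable (F φ H)

/-- The element `σ_t` of the Hecke algebra, for `t` in `K`. -/
abbrev sigmaInr (t : K) : heckeAlgebra F (H.map (inl : N →* N ⋊[φ] K)) := sigma F _ (inr t)

/-- The map `n H ↦ e_t φ_t(n) H` on the group algebra, where `e_t` is the average of the image of
`t H t⁻¹`. -/
def twist (t : K) : MonoidAlgebra F (N ⧸ H) →ₗ[F] MonoidAlgebra F (N ⧸ H) :=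
  Finsupp.linearCombination F (fun q : N ⧸ H => average F (conjImage φ H t) *
    MonoidAlgebra.of F (N ⧸ H) ((φ t q.out : N) : N ⧸ H)) ∘ₗ
      (MonoidAlgebra.coeffLinearEquiv F).toLinearMap

variable {F φ H}

/-- Independence of the representative: two of them differ by an element of `H`, whose image under
`φ_t` lies in `P_t` and is absorbed by `e_t`. -/
theorem twist_of (hH : IsHeckePair (H.map (inl : N →* N ⋊[φ] K))) (t : K) (m : N) :
    twist F φ H t (MonoidAlgebra.of F _ (m : N ⧸ H)) =
      average F (conjImage φ H t) * MonoidAlgebra.of F (N ⧸ H) ((φ t m : N) : N ⧸ H) := by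
  have h : twist F φ H t (MonoidAlgebra.of F _ (m : N ⧸ H)) =
      average F (conjImage φ H t) *
        MonoidAlgebra.of F (N ⧸ H) ((φ t (m : N ⧸ H).out : N) : N ⧸ H) := by
    simp [twist]
  have hm : m * ((m : N ⧸ H).out)⁻¹ ∈ H :=
    ‹H.Normal›.mem_comm (QuotientGroup.eq.1 (QuotientGroup.out_eq' (m : N ⧸ H)))
  have hmem : (((φ t (m * ((m : N ⧸ H).out)⁻¹) : N) : N ⧸ H)) ∈ conjImage φ H t :=
    (mem_conjImage φ H).2 ⟨_, hm, rfl⟩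
  rw [h]
  nth_rw 1 [← average_mul_of (hH.finite_conjImage t) hmem]
  rw [mul_assoc, ← map_mul, ← QuotientGroup.mk_mul, ← map_mul, inv_mul_cancel_right]

theorem twist_one_apply (hH : IsHeckePair (H.map (inl : N →* N ⋊[φ] K)))
    (t : K) : twist F φ H t 1 = average F (conjImage φ H t) := by
  have h := twist_of (F := F) hH t 1
  simpa only [QuotientGroup.mk_one, map_one, mul_one] using h

/-- Both `R(nt)` and the number of cosets in a translate equal the order of `P_t`, so the average
defining `σ_{nt}` is multiplication by `e_t`. -/
theorem heckeOp_embed (hH : IsHeckePair (H.map (inl : N →* N ⋊[φ] K)))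
    (n : N) (t s : K) (a : MonoidAlgebra F (N ⧸ H)) :
    heckeOp F (H.map (inl : N →* N ⋊[φ] K)) (inl n * inr t) (embed F φ H s a) =
      embed F φ H (t * s) (MonoidAlgebra.of F _ (n : N ⧸ H) * twist F φ H t a) := by
  suffices h : heckeOp F (H.map (inl : N →* N ⋊[φ] K)) (inl n * inr t) ∘ₗ embed F φ H s =
      embed F φ H (t * s) ∘ₗ LinearMap.mulLeft F (MonoidAlgebra.of F _ (n : N ⧸ H)) ∘ₗ
        twist F φ H t from LinearMap.congr_fun h a
  refine monoidAlgebra_linearMap_ext fun q => ?_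
  obtain ⟨m, rfl⟩ := QuotientGroup.mk_surjective q
  have hfin := map_average (F := F) (hH.finite_conjImage t)
    (embed F φ H (t * s) ∘ₗ LinearMap.mulLeft F (MonoidAlgebra.of F _ (n : N ⧸ H)) ∘ₗ
      LinearMap.mulRight F (MonoidAlgebra.of F _ ((φ t m : N) : N ⧸ H)))
  simp only [LinearMap.comp_apply, LinearMap.mulLeft_apply, LinearMap.mulRight_apply] at hfin ⊢
  rw [twist_of hH, hfin, embed_of, heckeOp, Finsupp.linearCombination_single, one_smul,
    cosetCount_inl_mul_inr, translates_cosetOf,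
    finsum_mem_image (cosetOf_mul_injective φ H _ _ _).injOn]
  congr 1
  refine finsum_mem_congr rfl fun p _ => ?_
  rw [← map_mul, ← map_mul, embed_of, mul_assoc]

theorem heckeOp_inr_embed (hH : IsHeckePair (H.map (inl : N →* N ⋊[φ] K)))
    (t s : K) (a : MonoidAlgebra F (N ⧸ H)) :
    heckeOp F (H.map (inl : N →* N ⋊[φ] K)) (inr t) (embed F φ H s a) =
      embed F φ H (t * s) (twist F φ H t a) := by
  have h := heckeOp_embed hH 1 t s a
  rwa [map_one, one_mul, QuotientGroup.mk_one, map_one, one_mul] at h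

theorem sigmaInr_embed (hH : IsHeckePair (H.map (inl : N →* N ⋊[φ] K)))
    (t s : K) (a : MonoidAlgebra F (N ⧸ H)) :
    (sigmaInr F φ H t).1 (embed F φ H s a) = embed F φ H (t * s) (twist F φ H t a) :=
  heckeOp_inr_embed hH t s a

/-! ### Composition of the twists -/

variable [CharZero F]

theorem twist_one_eq (hH : IsHeckePair (H.map (inl : N →* N ⋊[φ] K)))
    (a : MonoidAlgebra F (N ⧸ H)) : twist F φ H 1 a = a := by
  have he : average F (conjImage φ H (1 : K)) = 1 := by
    refine map_average_of_const (hH.finite_conjImage 1) LinearMap.id 1 fun p hp => ?_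
    obtain ⟨h, hh, rfl⟩ := (mem_conjImage φ H).1 hp
    rw [map_one, MulAut.one_apply, (QuotientGroup.eq_one_iff h).2 hh, map_one, LinearMap.id_apply]
  suffices h : twist F φ H (1 : K) = LinearMap.id from LinearMap.congr_fun h a
  refine monoidAlgebra_linearMap_ext fun q => ?_
  obtain ⟨m, rfl⟩ := QuotientGroup.mk_surjective q
  rw [twist_of hH, he, one_mul, map_one, MulAut.one_apply, LinearMap.id_apply]

theorem twist_mul (hH : IsHeckePair (H.map (inl : N →* N ⋊[φ] K)))
    (t : K) (a b : MonoidAlgebra F (N ⧸ H)) :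
    twist F φ H t (a * b) = twist F φ H t a * twist F φ H t b := by
  suffices h : (LinearMap.mul F _).compr₂ (twist F φ H t) =
      (LinearMap.mul F _).compl₁₂ (twist F φ H t) (twist F φ H t) from
    LinearMap.congr_fun₂ h a b
  refine monoidAlgebra_linearMap_ext fun p => monoidAlgebra_linearMap_ext fun q => ?_
  obtain ⟨n, rfl⟩ := QuotientGroup.mk_surjective p
  obtain ⟨m, rfl⟩ := QuotientGroup.mk_surjective q
  simp only [LinearMap.compr₂_apply, LinearMap.compl₁₂_apply, LinearMap.mul_apply']
  have hfin := hH.finite_conjImage t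
  rw [← map_mul, ← QuotientGroup.mk_mul, twist_of hH, twist_of hH, twist_of hH,
    mul_assoc, ← mul_assoc (MonoidAlgebra.of F _ _), ← average_mul_comm hfin, mul_assoc,
    ← mul_assoc (average F _) (average F _), average_mul_average hfin, ← map_mul,
    ← QuotientGroup.mk_mul, map_mul]

/-- Compute `e_{tr} T_t(e_r)` twice. Averaging over `P_{tr}` leaves `T_t(e_r)`, because `φ_{tr}(h)`
acts on it as `T_t(φ_r(h))` and `e_r` absorbs `φ_r(h)`. Expanding `e_r` instead, each term `e_{tr}
T_t(φ_r(h))` equals `e_t e_{tr}`. -/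
theorem twist_average (hH : IsHeckePair (H.map (inl : N →* N ⋊[φ] K)))
    (t r : K) : twist F φ H t (average F (conjImage φ H r)) =
    average F (conjImage φ H t) * average F (conjImage φ H (t * r)) := by
  set e := fun t : K => average F (conjImage φ H t)
  change twist F φ H t (e r) = e t * e (t * r)
  have htr : ∀ h, ((φ (t * r) h : N) : N ⧸ H) = (φ t (φ r h) : N) := fun h => by
    rw [map_mul, MulAut.mul_apply]
  have h1 : e (t * r) * twist F φ H t (e r) = twist F φ H t (e r) := by
    refine map_average_of_const (hH.finite_conjImage (t * r))
      (LinearMap.mulRight F (twist F φ H t (e r))) _ fun p hp => ?_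
    obtain ⟨h, hh, rfl⟩ := (mem_conjImage φ H).1 hp
    rw [LinearMap.mulRight_apply]
    calc _ = MonoidAlgebra.of F _ ((φ (t * r) h : N) : N ⧸ H) * twist F φ H t (1 * e r) := by
          rw [one_mul]
      _ = e t * MonoidAlgebra.of F _ ((φ t (φ r h) : N) : N ⧸ H) * twist F φ H t (e r) := by
          rw [twist_mul hH, twist_one_apply hH, ← mul_assoc, htr,
            average_mul_comm (hH.finite_conjImage t)]
      _ = twist F φ H t (e r) := by
          rw [← twist_of hH, ← twist_mul hH,
            of_mul_average (hH.finite_conjImage r) ((mem_conjImage φ H).2 ⟨h, hh, rfl⟩)]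
  have h2 : e (t * r) * twist F φ H t (e r) = e t * e (t * r) := by
    refine map_average_of_const (hH.finite_conjImage r)
      (LinearMap.mulLeft F (e (t * r)) ∘ₗ twist F φ H t) _ fun p hp => ?_
    obtain ⟨h, hh, rfl⟩ := (mem_conjImage φ H).1 hp
    rw [LinearMap.comp_apply, LinearMap.mulLeft_apply, twist_of hH, ← htr,
      average_mul_comm (hH.finite_conjImage (t * r)), mul_assoc,
      of_mul_average (hH.finite_conjImage (t * r)) ((mem_conjImage φ H).2 ⟨h, hh, rfl⟩)]
  rw [← h1, h2]

theorem twist_twist (hH : IsHeckePair (H.map (inl : N →* N ⋊[φ] K)))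
    (t r : K) (a : MonoidAlgebra F (N ⧸ H)) :
    twist F φ H t (twist F φ H r a) = twist F φ H t 1 * twist F φ H (t * r) a := by
  suffices h : twist F φ H t ∘ₗ twist F φ H r =
      LinearMap.mulLeft F (twist F φ H t 1) ∘ₗ twist F φ H (t * r) from LinearMap.congr_fun h a
  refine monoidAlgebra_linearMap_ext fun q => ?_
  obtain ⟨m, rfl⟩ := QuotientGroup.mk_surjective q
  have hfin := hH.finite_conjImage t
  rw [LinearMap.comp_apply, LinearMap.comp_apply, LinearMap.mulLeft_apply, twist_one_apply hH,
    twist_of hH, twist_of hH, twist_mul hH, twist_average hH, twist_of hH, ← mul_assoc,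
    mul_assoc (average F _) (average F _), ← average_mul_comm hfin, ← mul_assoc (average F _),
    average_mul_average hfin, mul_assoc, map_mul φ, MulAut.mul_apply]

/-- The compression of the group algebra of `N ⧸ H` by the elements of `K`. -/
def heckeCompression (hH : IsHeckePair (H.map (inl : N →* N ⋊[φ] K))) :
    PartialAction.Compression F K (MonoidAlgebra F (N ⧸ H)) where
  T := twist F φ H
  map_mul := twist_mul hH
  one := twist_one_eq hH
  central t a := by
    rw [twist_one_apply hH]
    exact average_mul_comm (hH.finite_conjImage t) a
  comp := twist_twist hH

/-! ### The group algebra inside the Hecke algebra -/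

theorem heckeOp_inl_embed (hH : IsHeckePair (H.map (inl : N →* N ⋊[φ] K)))
    (n : N) (s : K) (a : MonoidAlgebra F (N ⧸ H)) :
    heckeOp F (H.map (inl : N →* N ⋊[φ] K)) (inl n) (embed F φ H s a) =
      embed F φ H s (MonoidAlgebra.of F _ (n : N ⧸ H) * a) := by
  have h := heckeOp_embed hH n 1 s a
  rwa [map_one, mul_one, one_mul, twist_one_eq hH] at h

/-- The embedding of the group algebra of `N ⧸ H` into the Hecke algebra. -/
def groupAlgebraHom (hH : IsHeckePair (H.map (inl : N →* N ⋊[φ] K))) :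
    MonoidAlgebra F (N ⧸ H) →ₐ[F] heckeAlgebra F (H.map (inl : N →* N ⋊[φ] K)) :=
  MonoidAlgebra.lift F _ _
    -- The choice of representative is harmless: `σ_n` acts as left multiplication by `nH` on every
    -- copy.
    { toFun := fun q => sigma F _ (inl q.out)
      map_one' := Subtype.ext <| end_ext fun s a => by
        change heckeOp F _ _ _ = embed F φ H s a
        rw [heckeOp_inl_embed hH, QuotientGroup.out_eq', map_one, one_mul]
      map_mul' := fun p q => Subtype.ext <| end_ext fun s a => by
        change heckeOp F _ _ _ = heckeOp F _ _ (heckeOp F _ _ _)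
        rw [heckeOp_inl_embed hH, heckeOp_inl_embed hH, heckeOp_inl_embed hH,
          QuotientGroup.out_eq', QuotientGroup.out_eq', QuotientGroup.out_eq',
          map_mul (MonoidAlgebra.of F (N ⧸ H)), mul_assoc] }

theorem groupAlgebraHom_embed (hH : IsHeckePair (H.map (inl : N →* N ⋊[φ] K)))
    (b : MonoidAlgebra F (N ⧸ H)) (s : K)
    (a : MonoidAlgebra F (N ⧸ H)) :
    (groupAlgebraHom hH b).1 (embed F φ H s a) = embed F φ H s (b * a) := by
  induction b using MonoidAlgebra.induction_on with
  | of q =>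
    rw [groupAlgebraHom, MonoidAlgebra.lift_of]
    change heckeOp F _ _ _ = _
    rw [heckeOp_inl_embed hH, QuotientGroup.out_eq']
  | add b c hb hc => simp [add_mul, hb, hc]
  | smul r b hb => simp [hb]

theorem groupAlgebraHom_of (hH : IsHeckePair (H.map (inl : N →* N ⋊[φ] K))) (n : N) :
    groupAlgebraHom hH (MonoidAlgebra.of F (N ⧸ H) n) = sigma F _ (inl n) :=
  Subtype.ext <| end_ext fun s a =>
    (groupAlgebraHom_embed hH _ s a).trans (heckeOp_inl_embed hH n s a).symm

theorem groupAlgebraHom_injective (hH : IsHeckePair (H.map (inl : N →* N ⋊[φ] K))) :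
    Function.Injective (groupAlgebraHom (F := F) hH) := by
  intro a b h
  have h' : embed F φ H 1 (a * 1) = embed F φ H 1 (b * 1) := by
    rw [← groupAlgebraHom_embed hH, ← groupAlgebraHom_embed hH, h]
  rw [mul_one, mul_one] at h'
  ext q
  rw [← embed_apply_self F φ H 1, h', embed_apply_self]

theorem sigma_inr_mul_groupAlgebraHom (hH : IsHeckePair (H.map (inl : N →* N ⋊[φ] K)))
    (t : K) (a : MonoidAlgebra F (N ⧸ H)) :
    sigmaInr F φ H t * groupAlgebraHom hH a =
      groupAlgebraHom hH (twist F φ H t a) * sigmaInr F φ H t :=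
  Subtype.ext <| end_ext fun s b => by
    rw [heckeAlgebra_mul_apply, heckeAlgebra_mul_apply, groupAlgebraHom_embed, sigmaInr_embed hH,
      sigmaInr_embed hH, groupAlgebraHom_embed, twist_mul hH]

theorem sigma_inr_mul_sigma_inr (hH : IsHeckePair (H.map (inl : N →* N ⋊[φ] K))) (t r : K) :
    sigmaInr F φ H t * sigmaInr F φ H r =
      groupAlgebraHom hH (twist F φ H t 1) * sigmaInr F φ H (t * r) :=
  Subtype.ext <| end_ext fun s b => by
    rw [heckeAlgebra_mul_apply, heckeAlgebra_mul_apply, sigmaInr_embed hH, sigmaInr_embed hH,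
      sigmaInr_embed hH, groupAlgebraHom_embed, twist_twist hH, mul_assoc]

theorem sigma_inr_one (hH : IsHeckePair (H.map (inl : N →* N ⋊[φ] K))) : sigmaInr F φ H 1 = 1 :=
  Subtype.ext <| end_ext fun s b => by
    rw [sigmaInr_embed hH, twist_one_eq hH, one_mul]
    rfl

theorem sigma_inr_mul_sigma_inr_inv (hH : IsHeckePair (H.map (inl : N →* N ⋊[φ] K))) (t : K) :
    sigmaInr F φ H t * sigmaInr F φ H t⁻¹ = groupAlgebraHom hH (twist F φ H t 1) := by
  rw [sigma_inr_mul_sigma_inr hH, mul_inv_cancel, sigma_inr_one hH, mul_one]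

theorem groupAlgebraHom_twist_one_mul (hH : IsHeckePair (H.map (inl : N →* N ⋊[φ] K))) (t : K) :
    groupAlgebraHom hH (twist F φ H t 1) * sigmaInr F φ H t = sigmaInr F φ H t := by
  rw [← sigma_inr_mul_groupAlgebraHom, map_one, mul_one]

theorem sigma_inl_mul_inr (hH : IsHeckePair (H.map (inl : N →* N ⋊[φ] K))) (n : N) (t : K) :
    sigma F (H.map (inl : N →* N ⋊[φ] K)) (inl n * inr t) =
      sigma F _ (inl n) * sigmaInr F φ H t :=
  Subtype.ext <| end_ext fun s b => by
    change heckeOp F _ _ _ = heckeOp F _ _ (heckeOp F _ _ _)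
    rw [heckeOp_inr_embed hH, heckeOp_inl_embed hH, heckeOp_embed hH]

/-! ### The isomorphism with the crossed product -/

/-- The map from the crossed product to the Hecke algebra. -/
def crossedToHecke (hH : IsHeckePair (H.map (inl : N →* N ⋊[φ] K))) :
    (heckeCompression (F := F) hH).partialAction.CrossedProduct →ₗ[F]
    heckeAlgebra F (H.map (inl : N →* N ⋊[φ] K)) :=
  (heckeCompression hH).crossedProductMap (groupAlgebraHom hH) (sigmaInr F φ H)

theorem crossedToHecke_δ (hH : IsHeckePair (H.map (inl : N →* N ⋊[φ] K)))
    (t : K) (a : (heckeCompression (F := F) hH).partialAction.D t) :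
    crossedToHecke hH ((heckeCompression hH).partialAction.δ t a) =
      groupAlgebraHom hH a * sigmaInr F φ H t :=
  (heckeCompression hH).crossedProductMap_δ (groupAlgebraHom hH) (sigmaInr F φ H) t a

theorem crossedToHecke_mul (hH : IsHeckePair (H.map (inl : N →* N ⋊[φ] K)))
    (x y : (heckeCompression (F := F) hH).partialAction.CrossedProduct) :
    crossedToHecke hH (x * y) = crossedToHecke hH x * crossedToHecke hH y :=
  (heckeCompression hH).crossedProductMap_mul (groupAlgebraHom hH) (sigmaInr F φ H)
    (sigma_inr_mul_groupAlgebraHom hH)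
    (sigma_inr_mul_sigma_inr hH) x y

theorem crossedToHecke_surjective (hH : IsHeckePair (H.map (inl : N →* N ⋊[φ] K))) :
    Function.Surjective (crossedToHecke (F := F) hH) := by
  have hgen (n : N) (t : K) : ∃ x, crossedToHecke hH x =
      sigma F (H.map (inl : N →* N ⋊[φ] K)) (inl n * inr t) := by
    rw [sigma_inl_mul_inr hH, ← groupAlgebraHom_of hH]
    exact (heckeCompression hH).mul_crossedProductMap_mem (groupAlgebraHom hH) (sigmaInr F φ H) t
      (groupAlgebraHom_twist_one_mul hH t) _
  suffices h : ∀ y (hy : y ∈ heckeAlgebra F (H.map (inl : N →* N ⋊[φ] K))),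
      ∃ x, (crossedToHecke hH x).1 = y from fun ⟨y, hy⟩ => (h y hy).imp fun _ => Subtype.ext
  intro y hy
  induction hy using Algebra.adjoin_induction with
  | mem x hx =>
    obtain ⟨g, rfl⟩ := hx
    obtain ⟨n, t, rfl⟩ := exists_eq_inl_mul_inr φ g
    exact (hgen n t).imp fun _ => congrArg Subtype.val
  | algebraMap r =>
    -- Scalars are multiples of `σ_1`, which is the identity operator.
    obtain ⟨x, hx⟩ := hgen 1 1
    rw [map_one, one_mul] at hx
    replace hx := hx.trans (sigma_inr_one hH)
    exact ⟨r • x, by rw [map_smul, hx, ← Algebra.algebraMap_eq_smul_one]; rfl⟩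
  | add x y _ _ h h' =>
    obtain ⟨a, rfl⟩ := h
    obtain ⟨b, rfl⟩ := h'
    exact ⟨a + b, by rw [map_add]; rfl⟩
  | mul x y _ _ h h' =>
    obtain ⟨a, rfl⟩ := h
    obtain ⟨b, rfl⟩ := h'
    exact ⟨a * b, by rw [crossedToHecke_mul]; rfl⟩

/-- The vector `embed 1 1` is the basis vector of the coset `H`. Applying `ι(a) σ_t` to it gives `a
e_t = a` in the copy of `t`, so distinct `t` do not interfere; injectivity rests on this. -/
theorem crossedToHecke_δ_apply (hH : IsHeckePair (H.map (inl : N →* N ⋊[φ] K)))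
    (t : K) (a : (heckeCompression (F := F) hH).partialAction.D t) :
    (crossedToHecke hH ((heckeCompression hH).partialAction.δ t a)).1 (embed F φ H 1 1) =
      embed F φ H t a.1 := by
  have ha : a.1 * twist F φ H t 1 = a.1 :=
    ((heckeCompression hH).central t a.1).symm.trans a.2
  rw [crossedToHecke_δ, heckeAlgebra_mul_apply, sigmaInr_embed hH, groupAlgebraHom_embed, ha,
    mul_one]

theorem crossedToHecke_apply_coset (hH : IsHeckePair (H.map (inl : N →* N ⋊[φ] K))) 
    (x : (heckeCompression (F := F) hH).partialAction.CrossedProduct) (t : K) (q : N ⧸ H) :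
    (crossedToHecke hH x).1 (embed F φ H 1 1) (cosetOf φ H t q) =
      ((heckeCompression (F := F) hH).partialAction.component t x :
        MonoidAlgebra F (N ⧸ H)).coeff q := by
  induction x using PartialAction.crossedProduct_induction with
  | zero => simp
  | add x y hx hy => simp [hx, hy]
  | δ s a =>
    rw [crossedToHecke_δ_apply]
    by_cases hst : s = t
    · subst hst
      rw [embed_apply_self, PartialAction.component_δ_self]
    · rw [embed_apply_of_ne F φ H hst, PartialAction.component_δ_of_ne _ hst]
      rfl

theorem crossedToHecke_injective (hH : IsHeckePair (H.map (inl : N →* N ⋊[φ] K))) :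
    Function.Injective (crossedToHecke (F := F) hH) := by
  intro x y h
  refine PartialAction.crossedProduct_ext _ fun t => Subtype.ext ?_
  ext q
  rw [← crossedToHecke_apply_coset, ← crossedToHecke_apply_coset, h]

end Semidirect

end HeckeCrossed

end

open HeckeCrossed SemidirectProduct in
theorem corollary11p10 {F N K : Type*} [Field F] [CharZero F] [Group N] [Group K]
    (φ : K →* MulAut N) (H : Subgroup N) [H.Normal]
    (hH : IsHeckePair (H.map (inl : N →* N ⋊[φ] K))) :
    ∃ (Θ : PartialAction F K (MonoidAlgebra F (N ⧸ H)))
      (Φ : Θ.CrossedProduct ≃ₗ[F] heckeAlgebra F (H.map (inl : N →* N ⋊[φ] K)))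
      (ι : MonoidAlgebra F (N ⧸ H) →ₐ[F] heckeAlgebra F (H.map (inl : N →* N ⋊[φ] K))),
      -- `Φ` is an isomorphism of algebras
      (∀ a b, Φ (a * b) = Φ a * Φ b) ∧
      -- `ι` is the canonical embedding of the group algebra into the Hecke algebra
      Function.Injective ι ∧
      (∀ n : N, ι (MonoidAlgebra.of F (N ⧸ H) n) = sigma F _ (inl n)) ∧
      -- through `ι`, the partial action is compression by the elements of `K`
      (∀ t a, a ∈ Θ.D t ↔ ∃ b, ι a = sigma F _ (inr t) * sigma F _ (inr t⁻¹) * ι b) ∧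
      (∀ t (a : Θ.D t⁻¹), ι (Θ.θ t a) = sigma F _ (inr t) * ι a * sigma F _ (inr t⁻¹)) ∧
      (∀ t (a : Θ.D t), Φ (Θ.δ t a) = ι a * sigma F _ (inr t)) := by
  refine ⟨(heckeCompression hH).partialAction,
    LinearEquiv.ofBijective (crossedToHecke hH)
      ⟨crossedToHecke_injective hH, crossedToHecke_surjective hH⟩,
    groupAlgebraHom hH, crossedToHecke_mul hH, groupAlgebraHom_injective hH,
    groupAlgebraHom_of hH, fun t a => ?_, fun t a => ?_, fun t a => ?_⟩
  · simp only [sigma_inr_mul_sigma_inr_inv hH, ← map_mul, (groupAlgebraHom_injective hH).eq_iff]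
    exact (heckeCompression hH).mem_ideal_iff_exists
  -- Covariance gives `σ_t ι(a) σ_{t⁻¹} = ι(T_t(a)) σ_t σ_{t⁻¹} = ι(T_t(a) T_t(1))`, and `T_t(a)
  -- T_t(1) = T_t(a)`.
  · rw [sigma_inr_mul_groupAlgebraHom, mul_assoc, sigma_inr_mul_sigma_inr_inv hH, ← map_mul,
      ← twist_mul hH, mul_one]
    rfl
  · exact crossedToHecke_δ hH t a
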